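/- Let $m,n,s$ be nonnegative integers with $s\le m$, let $f\colon\mathbb{R}^m\to\mathbb{R}^n$ be linear, and let $h\colon\mathbb{R}^s\to\mathbb{R}^m$ be real analytic (each component is given by a convergent power series in a neighbourhood of every point). Suppose that its $s$-dimensional Jacobian $Jh(v)=\sqrt{\det\big((Dh(v))^{T}Dh(v)\big)}$, where $Dh(v)$ denotes the $m\times s$ Jacobian matrix of $h$ at $v$, is not identically zero on $\mathbb{R}^s$. Let $A\subseteq\mathbb{R}^s$ be a Lebesgue measurable set of positive Lebesgue measure. If $f$ is one-to-one on $h(A)$, then $n\ge s$. -/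

import Mathlib

open MeasureTheory Set
open scoped Matrix

/-- The Jacobian matrix (an `l × k` matrix) of `g : ℝ^k → ℝ^l` at `v`, that is, the matrix of the
differential `Dg(v)` with respect to the standard bases. -/
noncomputable def differentialMatrix {k l : ℕ}
    (g : EuclideanSpace ℝ (Fin k) → EuclideanSpace ℝ (Fin l)) (v : EuclideanSpace ℝ (Fin k)) :
    Matrix (Fin l) (Fin k) ℝ :=
  Matrix.of fun i j => fderiv ℝ g v (EuclideanSpace.single j 1) i

/-- The `min k l`-dimensional Jacobian `Jg(v)` of a differentiable map `g : ℝ^k → ℝ^l` at `v`: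
`√(det (Dg(v) Dg(v)ᵀ))` if `l < k`, and `√(det (Dg(v)ᵀ Dg(v)))` if `k ≤ l`. -/
noncomputable def jacobian {k l : ℕ}
    (g : EuclideanSpace ℝ (Fin k) → EuclideanSpace ℝ (Fin l)) (v : EuclideanSpace ℝ (Fin k)) : ℝ :=
  if l < k then √((differentialMatrix g v * (differentialMatrix g v)ᵀ).det)
  else √(((differentialMatrix g v)ᵀ * differentialMatrix g v).det)

section

open Filter Metric
open scoped Topology

/-! The Gram determinant of `Dh` is analytic and not identically zero, so its zero set is null. Off
it `h` is locally injective, hence `f ∘ h` is injective on some compact set of positive measure. For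
`n < s` this contradicts `AnalyticOnNhd.not_injOn_of_volume_ne_zero`, proved by induction on `n`. If
the first component of the map is locally constant, it separates no points and is dropped. Otherwise
it serves as a local coordinate (`exists_openPartialHomeomorph_update`), and Fubini yields a level
set of positive measure in one dimension less, on which the remaining components must be injective.
-/

/-! ### Slicing and the identity theorem on sets of positive measure -/

theorem volume_setOf_slice_ne_zero {s : ℕ} (i : Fin (s + 1)) {S : Set (Fin (s + 1) → ℝ)}
    (hS : MeasurableSet S) (h : volume S ≠ 0) :
    volume {t : ℝ | volume {y : Fin s → ℝ | i.insertNth (α := fun _ => ℝ) t y ∈ S} ≠ 0} ≠ 0 := by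
  let e := MeasurableEquiv.piFinSuccAbove (fun _ : Fin (s + 1) => ℝ) i
  have he : MeasurePreserving e.symm volume volume :=
    (volume_preserving_piFinSuccAbove (fun _ : Fin (s + 1) => ℝ) i).symm e
  have hvol : volume (e.symm ⁻¹' S) = volume S := he.measure_preimage hS.nullMeasurableSet
  intro h0
  refine h ?_
  rw [← hvol]
  refine (Measure.measure_prod_null (e.symm.measurable hS)).2 ?_
  rw [Filter.EventuallyEq, ae_iff]
  exact h0

theorem AnalyticAt.insertNth {E : Type*} [NormedAddCommGroup E] [NormedSpace ℝ E] {s : ℕ}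
    (i : Fin (s + 1)) {a : E → ℝ} {b : E → Fin s → ℝ} {x : E}
    (ha : AnalyticAt ℝ a x) (hb : AnalyticAt ℝ b x) :
    AnalyticAt ℝ (fun z => i.insertNth (α := fun _ => ℝ) (a z) (b z)) x := by
  rw [analyticAt_pi_iff]
  intro j
  refine Fin.succAboveCases i ?_ (fun k => ?_) j
  · simpa using ha
  · simpa using analyticAt_pi_iff.1 hb k

/-- An analytic function on an open box vanishing on a set of positive measure is zero. -/
theorem AnalyticOnNhd.eqOn_zero_of_volume_ne_zero {F : Type*} [NormedAddCommGroup F]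
    [NormedSpace ℝ F] {s : ℕ} {I : Fin s → Set ℝ} (hI : ∀ i, IsPreconnected (I i))
    {f : (Fin s → ℝ) → F} (hf : AnalyticOnNhd ℝ f (univ.pi I)) {S : Set (Fin s → ℝ)}
    (hSI : S ⊆ univ.pi I) (hS : MeasurableSet S) (hvol : volume S ≠ 0)
    (hzero : ∀ x ∈ S, f x = 0) : EqOn f 0 (univ.pi I) := by
  induction s with
  | zero =>
    obtain ⟨x, hx⟩ := nonempty_of_measure_ne_zero hvol
    intro y _
    rw [Subsingleton.elim y x]
    exact hzero x hx
  | succ s ih =>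
    have hT := volume_setOf_slice_ne_zero 0 hS hvol
    set T := {t : ℝ | volume {y : Fin s → ℝ |
      (0 : Fin (s + 1)).insertNth (α := fun _ => ℝ) t y ∈ S} ≠ 0} with hTdef
    have hmem : ∀ (t : ℝ) (y : Fin s → ℝ),
        (0 : Fin (s + 1)).insertNth (α := fun _ => ℝ) t y ∈ univ.pi I ↔
          t ∈ I 0 ∧ y ∈ univ.pi (fun k => I k.succ) := by
      intro t y
      simp [Fin.forall_fin_succ]
    have hTI : T ⊆ I 0 := by
      intro t ht
      obtain ⟨y, hy⟩ := nonempty_of_measure_ne_zero ht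
      exact ((hmem t y).1 (hSI hy)).1
    have hslice : ∀ t ∈ T, ∀ y ∈ univ.pi (fun k => I k.succ),
        f ((0 : Fin (s + 1)).insertNth (α := fun _ => ℝ) t y) = 0 := by
      intro t ht
      refine ih (I := fun k => I k.succ) (fun k => hI _)
        (f := fun y => f ((0 : Fin (s + 1)).insertNth (α := fun _ => ℝ) t y))
        (S := {y | (0 : Fin (s + 1)).insertNth (α := fun _ => ℝ) t y ∈ S}) ?_ ?_ ?_ ht ?_
      · intro y hy
        exact (hf _ ((hmem t y).2 ⟨hTI ht, hy⟩)).fun_comp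
          (AnalyticAt.insertNth 0 analyticAt_const analyticAt_id)
      · exact fun y hy => ((hmem t y).1 (hSI hy)).2
      · refine hS.preimage (Continuous.measurable ?_)
        fun_prop
      · exact fun y hy => hzero _ hy
    -- `T` has positive measure near `t₀` while points are null, so `t₀` is an accumulation point of
    -- `T` and the one-variable identity theorem applies.
    obtain ⟨t₀, ht₀, hpos⟩ := exists_mem_forall_mem_nhdsWithin_pos_measure hT
    have hacc : ∃ᶠ t in 𝓝[≠] t₀, t ∈ T := by
      rw [← mem_closure_ne_iff_frequently_within, _root_.mem_closure_iff]
      intro o ho hto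
      by_contra hne
      have h1 : o ∩ T ⊆ {t₀} := by
        intro t ht
        by_contra htne
        exact hne ⟨t, ht.1, ht.2, htne⟩
      have h2 := hpos (o ∩ T) (inter_comm o T ▸ inter_mem_nhdsWithin _ (ho.mem_nhds hto))
      exact h2.ne' (measure_mono_null h1 (by simp))
    intro x hx
    have hx' : (0 : Fin (s + 1)).insertNth (α := fun _ => ℝ) (x 0) (fun k => x k.succ) = x := by
      ext j
      refine Fin.cases ?_ (fun k => ?_) j <;> simp
    rw [← hx'] at hx ⊢
    obtain ⟨h0, hy⟩ := (hmem _ _).1 hx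
    refine AnalyticOnNhd.eqOn_zero_of_preconnected_of_frequently_eq_zero
      (f := fun t => f ((0 : Fin (s + 1)).insertNth (α := fun _ => ℝ) t (fun k => x k.succ)))
      (U := I 0) (z₀ := t₀) ?_ (hI 0) (hTI ht₀) ?_ h0
    · intro t ht
      have hline : AnalyticAt ℝ (fun t => (0 : Fin (s + 1)).insertNth (α := fun _ => ℝ) t
          (fun k => x k.succ)) t := AnalyticAt.insertNth 0 analyticAt_id analyticAt_const
      exact AnalyticAt.fun_comp (f := fun t => (0 : Fin (s + 1)).insertNth (α := fun _ => ℝ) t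
        (fun k => x k.succ)) (hf _ ((hmem t _).2 ⟨ht, hy⟩)) hline
    · exact hacc.mono fun t ht => hslice t ht _ hy

/-! ### Analytic maps that lower dimension -/

/-- If an analytic real function has nonzero `i`-th partial derivative at a point, replacing the
`i`-th coordinate by that function is an analytic local change of coordinates. -/
theorem exists_openPartialHomeomorph_update {s : ℕ} {u : (Fin s → ℝ) → ℝ} {q : Fin s → ℝ}
    (hu : AnalyticAt ℝ u q) {i : Fin s} (hi : fderiv ℝ u q (Pi.single i 1) ≠ 0) :
    ∃ Φ : OpenPartialHomeomorph (Fin s → ℝ) (Fin s → ℝ), q ∈ Φ.source ∧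
      (∀ x, Φ x = Function.update x i (u x)) ∧ AnalyticAt ℝ Φ.symm (Φ q) := by
  let G : (Fin s → ℝ) → (Fin s → ℝ) := fun x => Function.update x i (u x)
  have hG : AnalyticAt ℝ G q := by
    rw [analyticAt_pi_iff]
    intro j
    by_cases hj : j = i
    · subst hj
      simpa [G] using hu
    · have h1 : (fun x => G x j) = ContinuousLinearMap.proj (R := ℝ) (φ := fun _ : Fin s => ℝ) j := by
        ext x
        simp [G, hj]
      rw [h1]
      exact ContinuousLinearMap.analyticAt _ q
  have hcoord : ∀ j v, fderiv ℝ G q v j = fderiv ℝ (fun x => G x j) q v := by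
    intro j v
    rw [fderiv_apply hG.differentiableAt]
    rfl
  -- The derivative is the identity except in row `i`, whose diagonal entry is `∂ᵢu(q) ≠ 0`.
  have hinj : Function.Injective (fderiv ℝ G q) := by
    rw [injective_iff_map_eq_zero]
    intro v hv
    have hne : ∀ j, j ≠ i → v j = 0 := by
      intro j hj
      have h1 := hcoord j v
      have h2 : (fun x => G x j) = ContinuousLinearMap.proj (R := ℝ) (φ := fun _ : Fin s => ℝ) j := by
        ext x
        simp [G, hj]
      rw [h2, ContinuousLinearMap.fderiv, hv] at h1
      simpa using h1.symm
    have hv' : v = v i • Pi.single i (1 : ℝ) := by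
      ext j
      by_cases hj : j = i
      · subst hj
        simp
      · simp [hj, hne j hj]
    have h1 := hcoord i v
    have h2 : (fun x => G x i) = u := by
      ext x
      simp [G]
    rw [h2, hv, hv', map_smul] at h1
    have h3 : v i = 0 := by
      simpa [hi] using h1.symm
    rw [hv', h3, zero_smul]
  let D : (Fin s → ℝ) ≃L[ℝ] (Fin s → ℝ) :=
    (LinearEquiv.ofInjectiveEndo (fderiv ℝ G q : (Fin s → ℝ) →ₗ[ℝ] (Fin s → ℝ))
      hinj).toContinuousLinearEquiv
  have hD : (D : (Fin s → ℝ) →L[ℝ] (Fin s → ℝ)) = fderiv ℝ G q := by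
    ext v
    rfl
  have hstrict : HasStrictFDerivAt G (D : (Fin s → ℝ) →L[ℝ] (Fin s → ℝ)) q := by
    rw [hD]
    exact hG.hasStrictFDerivAt
  refine ⟨hstrict.toOpenPartialHomeomorph G, hstrict.mem_toOpenPartialHomeomorph_source,
    fun x => rfl, ?_⟩
  exact OpenPartialHomeomorph.analyticAt_symm' _ (i := D)
    hstrict.mem_toOpenPartialHomeomorph_source hG hD.symm

/-- An analytic map to a space of smaller dimension is not injective on a compact set of positive
measure. -/
theorem AnalyticOnNhd.not_injOn_of_volume_ne_zero {s n : ℕ} (hns : n < s)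
    {g : (Fin s → ℝ) → (Fin n → ℝ)} {U : Set (Fin s → ℝ)} (hU : IsOpen U)
    (hg : AnalyticOnNhd ℝ g U) {K : Set (Fin s → ℝ)} (hK : IsCompact K) (hKU : K ⊆ U)
    (hvol : volume K ≠ 0) : ¬ InjOn g K := by
  induction n generalizing s with
  | zero =>
    intro hinj
    have hsub : K.Subsingleton := fun x hx y hy => hinj hx hy (Subsingleton.elim _ _)
    have : Nonempty (Fin s) := ⟨⟨0, hns⟩⟩
    exact hvol (hsub.measure_zero volume)
  | succ n ih =>
    intro hinj
    obtain ⟨s, rfl⟩ : ∃ s', s = s' + 1 := ⟨s - 1, by omega⟩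
    have htail : ∀ {V : Set (Fin (s + 1) → ℝ)}, AnalyticOnNhd ℝ g V →
        AnalyticOnNhd ℝ (fun x (k : Fin n) => g x k.succ) V := fun h x hx =>
      analyticAt_pi_iff.2 fun k => analyticAt_pi_iff.1 (h x hx) k.succ
    obtain ⟨p, hpK, hp⟩ := exists_mem_forall_mem_nhdsWithin_pos_measure hvol
    obtain ⟨r, hr, hrU⟩ := Metric.isOpen_iff.1 hU p (hKU hpK)
    have hg0 : AnalyticOnNhd ℝ (fun x => g x 0) (ball p r) := fun x hx =>
      analyticAt_pi_iff.1 (hg x (hrU hx)) 0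
    have hsubball : K ∩ closedBall p (r / 2) ⊆ ball p r :=
      inter_subset_right.trans (closedBall_subset_ball (by linarith))
    have hK1 : IsCompact (K ∩ closedBall p (r / 2)) := hK.inter_right isClosed_closedBall
    have hK1vol : volume (K ∩ closedBall p (r / 2)) ≠ 0 :=
      (hp _ (inter_mem_nhdsWithin _ (closedBall_mem_nhds p (by linarith)))).ne'
    by_cases hcase : ∃ i : Fin (s + 1), volume {x ∈ K ∩ closedBall p (r / 2) |
        fderiv ℝ (fun x => g x 0) x (Pi.single i 1) ≠ 0} ≠ 0
    · obtain ⟨i, hi⟩ := hcase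
      obtain ⟨q, ⟨hqK, hqi⟩, hq⟩ := exists_mem_forall_mem_nhdsWithin_pos_measure hi
      obtain ⟨Φ, hqΦ, hΦ, hΦsymm⟩ :=
        exists_openPartialHomeomorph_update (hg0 q (hsubball hqK)) hqi
      have hgq : AnalyticAt ℝ (g ∘ Φ.symm) (Φ q) := by
        refine AnalyticAt.comp ?_ hΦsymm
        rw [Φ.left_inv hqΦ]
        exact hg q (hKU hqK.1)
      have hcont : ContinuousAt Φ q := Φ.continuousAt hqΦ
      have hW : ∀ᶠ x in 𝓝 q, x ∈ Φ.source ∧ AnalyticAt ℝ (g ∘ Φ.symm) (Φ x) ∧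
          AnalyticAt ℝ Φ.symm (Φ x) :=
        (Φ.open_source.eventually_mem hqΦ).and
          ((hcont.eventually hgq.eventually_analyticAt).and
            (hcont.eventually hΦsymm.eventually_analyticAt))
      obtain ⟨ε, hε, hεW⟩ := Metric.nhds_basis_closedBall.eventually_iff.1 hW
      set K' := K ∩ closedBall q ε with hK'def
      have hK' : IsCompact K' := hK.inter_right isClosed_closedBall
      have hK'vol : volume K' ≠ 0 := by
        have h1 := hq _ (inter_mem_nhdsWithin _ (closedBall_mem_nhds q hε))
        refine fun h0 => h1.ne' (measure_mono_null ?_ h0)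
        exact fun x hx => ⟨hx.1.1.1, hx.2⟩
      have hK'W := fun x (hx : x ∈ K') => hεW hx.2
      have hL : IsCompact (Φ '' K') :=
        hK'.image_of_continuousOn (Φ.continuousOn.mono fun x hx => (hK'W x hx).1)
      -- The differentiable map `Φ.symm` would carry a null image back to a null `K'`.
      have hLvol : volume (Φ '' K') ≠ 0 := by
        intro h0
        refine hK'vol ?_
        have h1 : Φ.symm '' (Φ '' K') = K' := by
          rw [image_image]
          exact (image_congr fun x hx => Φ.left_inv (hK'W x hx).1).trans (image_id' K')
        rw [← h1]
        refine addHaar_image_eq_zero_of_differentiableOn_of_addHaar_eq_zero volume ?_ h0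
        rintro _ ⟨x, hx, rfl⟩
        exact (hK'W x hx).2.2.differentiableAt.differentiableWithinAt
      -- The slice at height `c` in coordinate `i` is the `Φ`-image of the part of `K'` where `g x 0
      -- = c`.
      obtain ⟨c, hc⟩ := nonempty_of_measure_ne_zero
        (volume_setOf_slice_ne_zero i hL.isClosed.measurableSet hLvol)
      let ι : (Fin s → ℝ) → (Fin (s + 1) → ℝ) := fun y => i.insertNth (α := fun _ => ℝ) c y
      have hι : Continuous ι := by fun_prop
      have hιleft : Function.LeftInverse (fun z k => z (i.succAbove k)) ι := fun y => by simp [ι]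
      have hιinj : Function.Injective ι := hιleft.injective
      have hιan : ∀ y, AnalyticAt ℝ ι y := fun y =>
        AnalyticAt.insertNth i analyticAt_const analyticAt_id
      have hιemb : Topology.IsClosedEmbedding ι :=
        hιleft.isClosedEmbedding (by fun_prop) hι
      refine ih (s := s) (by omega) (g := fun y (k : Fin n) => (g ∘ Φ.symm) (ι y) k.succ)
        (U := ι ⁻¹' {z | AnalyticAt ℝ (g ∘ Φ.symm) z})
        ((isOpen_analyticAt ℝ _).preimage hι) ?_ (K := ι ⁻¹' (Φ '' K'))
        (hιemb.isCompact_preimage hL) ?_ hc ?_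
      · intro y hy
        have h1 : AnalyticAt ℝ ((g ∘ Φ.symm) ∘ ι) y := AnalyticAt.comp hy (hιan y)
        exact analyticAt_pi_iff.2 fun k => analyticAt_pi_iff.1 h1 k.succ
      · rintro y ⟨x, hx, hxy⟩
        rw [mem_preimage, ← hxy]
        exact (hK'W x hx).2.1
      · rintro y ⟨x, hx, hxy⟩ y' ⟨x', hx', hxy'⟩ heq
        have hback : ∀ {x y}, x ∈ K' → Φ x = ι y → (g ∘ Φ.symm) (ι y) = g x ∧ g x 0 = c := by
          intro x y hx hxy
          refine ⟨by rw [← hxy, Function.comp_apply, Φ.left_inv (hK'W x hx).1], ?_⟩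
          have h1 := congrFun hxy i
          rw [hΦ] at h1
          simpa [ι] using h1
        obtain ⟨h1, h2⟩ := hback hx hxy
        obtain ⟨h1', h2'⟩ := hback hx' hxy'
        have hxx : x = x' := by
          refine hinj hx.1 hx'.1 (funext fun k => ?_)
          refine Fin.cases (h2.trans h2'.symm) (fun k => ?_) k
          have h3 := congrFun heq k
          simpa only [h1, h1'] using h3
        exact hιinj (by rw [← hxy, ← hxy', hxx])
    · push Not at hcase
      have hball : ball p r = univ.pi fun j => ball (p j) r := (ball_pi p hr)
      -- Each partial derivative vanishes almost everywhere on a non-null set, hence on the whole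
      -- ball.
      have hpart : ∀ i : Fin (s + 1), ∀ x ∈ ball p r,
          fderiv ℝ (fun x => g x 0) x (Pi.single i 1) = 0 := by
        intro i
        have han : AnalyticOnNhd ℝ (fun x => fderiv ℝ (fun x => g x 0) x (Pi.single i 1))
            (ball p r) := fun x hx =>
          ((ContinuousLinearMap.apply ℝ ℝ (Pi.single i (1 : ℝ) : Fin (s + 1) → ℝ)).analyticAt
            _).fun_comp (hg0 x hx).fderiv
        have hopen : IsOpen (ball p r ∩
            (fun x => fderiv ℝ (fun x => g x 0) x (Pi.single i 1)) ⁻¹' {0}ᶜ) :=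
          han.continuousOn.isOpen_inter_preimage isOpen_ball isOpen_compl_singleton
        rw [hball] at han ⊢
        refine han.eqOn_zero_of_volume_ne_zero (fun j => (convex_ball _ _).isPreconnected)
          (S := (K ∩ closedBall p (r / 2)) \ (ball p r ∩
            (fun x => fderiv ℝ (fun x => g x 0) x (Pi.single i 1)) ⁻¹' {0}ᶜ)) ?_ ?_ ?_ ?_
        · rw [← hball]
          exact sdiff_subset.trans hsubball
        · exact hK1.isClosed.measurableSet.diff hopen.measurableSet
        · rw [measure_sdiff_null']
          · exact hK1vol
          · exact measure_mono_null (t := {x ∈ K ∩ closedBall p (r / 2) |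
              fderiv ℝ (fun x => g x 0) x (Pi.single i 1) ≠ 0})
              (fun x hx => ⟨hx.1, hx.2.2⟩) (hcase i)
        · intro x hx
          by_contra hne
          exact hx.2 ⟨hsubball hx.1, hne⟩
      have hconst : ∀ x ∈ ball p r, ∀ y ∈ ball p r, g x 0 = g y 0 := by
        intro x hx y hy
        refine isOpen_ball.is_const_of_fderiv_eq_zero (𝕜 := ℝ) (f := fun x => g x 0)
          (convex_ball p r).isPreconnected hg0.differentiableOn ?_ hx hy
        intro z hz
        refine ContinuousLinearMap.coe_injective (LinearMap.pi_ext' fun i => ?_)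
        ext
        simpa using hpart i z hz
      refine ih (s := s + 1) (by omega) hU (htail hg) hK1 (inter_subset_left.trans hKU) hK1vol ?_
      intro x hx y hy heq
      refine hinj hx.1 hy.1 (funext fun k => ?_)
      refine Fin.cases (hconst x (hsubball hx) y (hsubball hy)) (fun k => congrFun heq k) k

/-! ### Local injectivity and the Gram determinant -/

/-- A map whose strict derivative at a point is injective is injective near that point. -/
theorem HasStrictFDerivAt.exists_mem_nhds_injOn {E F : Type*} [NormedAddCommGroup E]
    [NormedSpace ℝ E] [NormedAddCommGroup F] [NormedSpace ℝ F] [FiniteDimensional ℝ E]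
    [FiniteDimensional ℝ F] {h : E → F} {h' : E →L[ℝ] F} {x : E}
    (hh : HasStrictFDerivAt h h' x) (hinj : Function.Injective h') :
    ∃ W ∈ 𝓝 x, InjOn h W := by
  -- `L ∘ h` has derivative the identity, so the inverse function theorem makes it injective near
  -- `x`.
  obtain ⟨L, hL⟩ := (h' : E →ₗ[ℝ] F).exists_leftInverse_of_injective (LinearMap.ker_eq_bot.2 hinj)
  have : CompleteSpace E := FiniteDimensional.complete ℝ E
  have h1 : HasStrictFDerivAt (fun z => LinearMap.toContinuousLinearMap L (h z))
      ((ContinuousLinearEquiv.refl ℝ E : E ≃L[ℝ] E) : E →L[ℝ] E) x := by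
    convert (LinearMap.toContinuousLinearMap L).hasStrictFDerivAt.comp x hh using 1
    ext v
    simpa using (LinearMap.congr_fun hL v).symm
  refine ⟨_, (h1.toOpenPartialHomeomorph _).open_source.mem_nhds
    h1.mem_toOpenPartialHomeomorph_source, fun y hy z hz hyz => ?_⟩
  refine (h1.toOpenPartialHomeomorph _).injOn hy hz ?_
  simp only [HasStrictFDerivAt.toOpenPartialHomeomorph_coe, hyz]

theorem injective_fderiv_of_det_ne_zero {s m : ℕ}
    {h : EuclideanSpace ℝ (Fin s) → EuclideanSpace ℝ (Fin m)} {v : EuclideanSpace ℝ (Fin s)}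
    (hdet : ((differentialMatrix h v)ᵀ * differentialMatrix h v).det ≠ 0) :
    Function.Injective (fderiv ℝ h v) := by
  rw [injective_iff_map_eq_zero]
  intro w hw
  have h1 : differentialMatrix h v *ᵥ w = 0 := by
    have h2 : w = ∑ j, w j • EuclideanSpace.single j (1 : ℝ) := by
      ext k
      simp [Pi.single_apply]
    rw [h2, map_sum] at hw
    ext i
    have h3 := congrArg (fun z : EuclideanSpace ℝ (Fin m) => z i) hw
    simpa [differentialMatrix, Matrix.mulVec, dotProduct, mul_comm] using h3
  have h4 := Matrix.eq_zero_of_mulVec_eq_zero hdet (v := w)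
    (by rw [← Matrix.mulVec_mulVec, h1, Matrix.mulVec_zero])
  ext k
  exact congrFun h4 k

/-- The determinant replaces the Jacobian because the square root is not analytic at zero. -/
theorem analyticAt_det_differentialMatrix {s m : ℕ}
    {h : EuclideanSpace ℝ (Fin s) → EuclideanSpace ℝ (Fin m)} {v : EuclideanSpace ℝ (Fin s)}
    (hh : AnalyticAt ℝ h v) :
    AnalyticAt ℝ (fun v => ((differentialMatrix h v)ᵀ * differentialMatrix h v).det) v := by
  have hentry : ∀ i j, AnalyticAt ℝ (fun v => differentialMatrix h v i j) v := fun i j =>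
    (((EuclideanSpace.proj i : EuclideanSpace ℝ (Fin m) →L[ℝ] ℝ).comp
      (ContinuousLinearMap.apply ℝ (EuclideanSpace ℝ (Fin m))
        (EuclideanSpace.single j (1 : ℝ)))).analyticAt _).fun_comp hh.fderiv
  simp only [Matrix.det_apply, Matrix.mul_apply, Matrix.transpose_apply, Units.smul_def,
    zsmul_eq_mul]
  refine Finset.analyticAt_fun_sum _ fun σ _ => analyticAt_const.mul ?_
  exact Finset.analyticAt_fun_prod _ fun i _ => Finset.analyticAt_fun_sum _ fun j _ =>
    (hentry _ _).mul (hentry _ _)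

end

/-! ### The main theorem -/

theorem theorem2 (m n s : ℕ)
    (f : EuclideanSpace ℝ (Fin m) →ₗ[ℝ] EuclideanSpace ℝ (Fin n))
    (h : EuclideanSpace ℝ (Fin s) → EuclideanSpace ℝ (Fin m))
    (h_analytic : AnalyticOnNhd ℝ h Set.univ)
    (h_dim : min s m = s)
    (h_jac : ∃ v, jacobian h v ≠ 0)
    (A : Set (EuclideanSpace ℝ (Fin s)))
    (hA : NullMeasurableSet A volume)
    (hA_pos : 0 < volume A)
    (h_inj : Set.InjOn f (h '' A)) :
    s ≤ n := by
  by_contra! hns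
  let e := EuclideanSpace.equiv (Fin s) ℝ
  let J : EuclideanSpace ℝ (Fin s) → ℝ := fun v =>
    ((differentialMatrix h v)ᵀ * differentialMatrix h v).det
  have he : MeasurePreserving e.symm volume volume := PiLp.volume_preserving_toLp (Fin s)
  have hean : ∀ x, AnalyticAt ℝ e.symm x := fun x =>
    (e.symm : (Fin s → ℝ) →L[ℝ] EuclideanSpace ℝ (Fin s)).analyticAt x
  obtain ⟨B, hBA, hB, hBae⟩ := hA.exists_measurable_subset_ae_eq
  have hC : MeasurableSet (e.symm ⁻¹' B) := e.symm.continuous.measurable hB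
  have hCvol : volume (e.symm ⁻¹' B) ≠ 0 := by
    rw [he.measure_preimage hB.nullMeasurableSet, measure_congr hBae]
    exact hA_pos.ne'
  have hJan : AnalyticOnNhd ℝ (fun x => J (e.symm x)) (univ.pi fun _ => univ) := fun x _ =>
    (analyticAt_det_differentialMatrix (h_analytic _ (mem_univ _))).fun_comp (hean x)
  have hJmeas : MeasurableSet {x | J (e.symm x) = 0} := by
    rw [pi_univ] at hJan
    exact (isClosed_singleton.preimage
      (continuousOn_univ.1 hJan.continuousOn)).measurableSet
  have hnull : volume (e.symm ⁻¹' B ∩ {x | J (e.symm x) = 0}) = 0 := by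
    by_contra hne
    obtain ⟨v, hv⟩ := h_jac
    refine hv ?_
    have h0 := hJan.eqOn_zero_of_volume_ne_zero (fun _ => isPreconnected_univ) (by simp)
      (hC.inter hJmeas) hne (fun x hx => hx.2) (x := e v) (by simp)
    have h1 : J v = 0 := by simpa using h0
    rw [jacobian, if_neg (by omega)]
    exact (congrArg Real.sqrt h1).trans Real.sqrt_zero
  have hDvol : volume (e.symm ⁻¹' B \ {x | J (e.symm x) = 0}) ≠ 0 := by
    rwa [measure_sdiff_null' hnull]
  obtain ⟨q, hq, hqpos⟩ := exists_mem_forall_mem_nhdsWithin_pos_measure hDvol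
  obtain ⟨W, hW, hWinj⟩ := (h_analytic _ (mem_univ (e.symm q))).hasStrictFDerivAt
    |>.exists_mem_nhds_injOn (injective_fderiv_of_det_ne_zero hq.2)
  obtain ⟨V, hVW, hV, hqV⟩ := mem_nhds_iff.1 hW
  have hpos := hqpos _ (inter_mem_nhdsWithin _
    ((hV.preimage e.symm.continuous).mem_nhds hqV))
  -- Inner regularity gives a compact set inside the region where `h` is injective.
  obtain ⟨K, hKsub, hK, hKpos⟩ := ((hC.diff hJmeas).inter
    (hV.preimage e.symm.continuous).measurableSet).exists_lt_isCompact hpos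
  let g : (Fin s → ℝ) → (Fin n → ℝ) := fun x =>
    EuclideanSpace.equiv (Fin n) ℝ (LinearMap.toContinuousLinearMap f (h (e.symm x)))
  have hg : AnalyticOnNhd ℝ g univ := fun x _ =>
    ((((EuclideanSpace.equiv (Fin n) ℝ : EuclideanSpace ℝ (Fin n) →L[ℝ] (Fin n → ℝ)).comp
      (LinearMap.toContinuousLinearMap f)).analyticAt _).fun_comp
        (h_analytic _ (mem_univ _))).fun_comp (hean x)
  refine hg.not_injOn_of_volume_ne_zero hns isOpen_univ hK (subset_univ _) hKpos.ne' ?_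
  intro x hx y hy hxy
  have h1 := (EuclideanSpace.equiv (Fin n) ℝ).injective hxy
  have h2 := h_inj ⟨_, hBA (hKsub hx).1.1, rfl⟩ ⟨_, hBA (hKsub hy).1.1, rfl⟩ h1
  exact e.symm.injective (hWinj (hVW (hKsub hx).2) (hVW (hKsub hy).2) h2)
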